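/- All graphs are finite, simple, undirected and nonempty (the number of vertices is at least one). For a graph $G$ let $A_G$ denote its adjacency matrix. Let $F$ be a graph with $k$ vertices and $G$ a graph with $n$ vertices. Write $\hom(F,G)$ for the number of homomorphisms from $F$ to $G$, and $t(F,G)=\hom(F,G)/n^{k}$. For $k\ge 1$ let $\mathcal T_k$ be the set of all trees with vertex set $\{1,\dots,k\}$. Define $$\delta_{\mathcal T}(G,H)=\sqrt{\sum_{k\ge 1}\frac{1}{2^k|\mathcal T_k|}\sum_{F\in\mathcal T_k}\bigl(t(F,G)-t(F,H)\bigr)^2}.$$ For graphs $G=(V,E_G)$ and $H=(W,E_H)$ with $m=|V|$ and $n=|W|$, let $\mathrm{DS}^*(V,W)$ be the set of all nonnegative real $V\times W$ matrices all of whose row sums are $1/m$ and all of whose column sums are $1/n$. For a norm $\|\cdot\|$ on $\mathbb R^{V\times W}$ define $$\delta^*_{\|\cdot\|}(G,H)=\min_{Q\in \mathrm{DS}^*(V,W)}\Bigl\|\tfrac1m A_GQ-\tfrac1n QA_H\Bigr\|.$$ The fractional edit distance $\delta^*_{(1)}$ is obtained from the entrywise norm $\|A\|_{(1)}=\sum_{v\in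 V,w\in W}|A(v,w)|$, and the fractional cut distance $\delta^*_\square$ from the cut norm $\|A\|_\square=\max_{S\subseteq V,\,T\subseteq W}\bigl|\sum_{v\in S,w\in T}A(v,w)\bigr|$. Then for all graphs $G,H$, not necessarily of the same order, $$\delta_{\mathcal T}(G,H)=0\iff\delta^*_{(1)}(G,H)=0\iff\delta^*_\square(G,H)=0.$$ -/

import Mathlib

namespace GraphDistance

noncomputable section

/-- The entrywise `1`-norm of a real matrix. -/
def entrywiseOneNorm {V W : Type*} [Fintype V] [Fintype W] (A : Matrix V W ℝ) : ℝ :=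
  ∑ v, ∑ w, |A v w|

/-- The cut norm of a real matrix: the maximum over all `S ⊆ V`, `T ⊆ W` of the absolute value
of the sum of the entries in `S × T`. -/
def cutNorm {V W : Type*} [Fintype V] [Fintype W] (A : Matrix V W ℝ) : ℝ :=
  (Finset.univ : Finset (Finset V × Finset W)).sup' Finset.univ_nonempty
    fun p => |∑ v ∈ p.1, ∑ w ∈ p.2, A v w|

/-- The nonnegative `V × W` matrices with all row sums `1 / |V|` and all column sums `1 / |W|`. -/
def DSStar (V W : Type*) [Fintype V] [Fintype W] : Set (Matrix V W ℝ) :=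
  {Q | (∀ v w, 0 ≤ Q v w) ∧ (∀ v, ∑ w, Q v w = 1 / (Fintype.card V : ℝ)) ∧
    ∀ w, ∑ v, Q v w = 1 / (Fintype.card W : ℝ)}

/-- The matrix `(1 / |V|) A_G Q - (1 / |W|) Q A_H`. -/
def discrepancy {V W : Type*} [Fintype V] [Fintype W] (G : SimpleGraph V) (H : SimpleGraph W)
    [DecidableRel G.Adj] [DecidableRel H.Adj] (Q : Matrix V W ℝ) : Matrix V W ℝ :=
  (1 / (Fintype.card V : ℝ)) • (G.adjMatrix ℝ * Q) -
    (1 / (Fintype.card W : ℝ)) • (Q * H.adjMatrix ℝ)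

/-- The fractional relaxation of the graph metric given by a matrix norm `N`: the minimum over
`Q ∈ DSStar V W` of `N ((1 / |V|) A_G Q - (1 / |W|) Q A_H)`. It is written as an infimum; that the
minimum is attained for continuous `N` is `fractionalDist_isLeast`. -/
def fractionalDist {V W : Type*} [Fintype V] [Fintype W] (N : Matrix V W ℝ → ℝ)
    (G : SimpleGraph V) (H : SimpleGraph W) [DecidableRel G.Adj] [DecidableRel H.Adj] : ℝ :=
  sInf ((fun Q => N (discrepancy G H Q)) '' DSStar V W)

/-- The fractional edit distance. -/
def fractionalEditDist {V W : Type*} [Fintype V] [Fintype W]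
    (G : SimpleGraph V) (H : SimpleGraph W) [DecidableRel G.Adj] [DecidableRel H.Adj] : ℝ :=
  fractionalDist entrywiseOneNorm G H

/-- The fractional cut distance. -/
def fractionalCutDist {V W : Type*} [Fintype V] [Fintype W]
    (G : SimpleGraph V) (H : SimpleGraph W) [DecidableRel G.Adj] [DecidableRel H.Adj] : ℝ :=
  fractionalDist cutNorm G H

/-- The homomorphism density of `F` in `G`: the number of homomorphisms from `F` to `G` divided
by the number of all mappings between the vertex sets. -/
def homDensity {U V : Type*} [Fintype U] [Fintype V] (F : SimpleGraph U) (G : SimpleGraph V) : ℝ :=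
  (Nat.card (F →g G) : ℝ) / (Fintype.card V : ℝ) ^ Fintype.card U

open Classical in
/-- For a class of finite graphs, given as a family of sets of graphs with vertex set `Fin k`,
the finite set of its members of order `k`. -/
def members (𝓕 : (k : ℕ) → Set (SimpleGraph (Fin k))) (k : ℕ) : Finset (SimpleGraph (Fin k)) :=
  Finset.univ.filter fun F => F ∈ 𝓕 k

/-- The term of order `k` in the series of `homDensityDist`. If the class has no members of
order `k`, then the inner sum is empty and the term is `0`. -/
def homDensityTerm {V W : Type*} [Fintype V] [Fintype W]
    (𝓕 : (k : ℕ) → Set (SimpleGraph (Fin k))) (G : SimpleGraph V) (H : SimpleGraph W)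
    (k : ℕ) : ℝ :=
  1 / (2 ^ k * ((members 𝓕 k).card : ℝ)) *
    ∑ F ∈ members 𝓕 k, (homDensity F G - homDensity F H) ^ 2

/-- The homomorphism-density metric over the class `𝓕`. The series converges for all nonempty
graphs by `summable_homDensityTerm`. -/
def homDensityDist {V W : Type*} [Fintype V] [Fintype W]
    (𝓕 : (k : ℕ) → Set (SimpleGraph (Fin k))) (G : SimpleGraph V) (H : SimpleGraph W) : ℝ :=
  Real.sqrt (∑' k : ℕ, homDensityTerm 𝓕 G H k)

/-- The class of all trees. -/
def trees (k : ℕ) : Set (SimpleGraph (Fin k)) := {F | F.IsTree}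

theorem continuous_entrywiseOneNorm {V W : Type*} [Fintype V] [Fintype W] :
    Continuous (entrywiseOneNorm : Matrix V W ℝ → ℝ) := by
  unfold entrywiseOneNorm
  fun_prop

theorem continuous_cutNorm {V W : Type*} [Fintype V] [Fintype W] :
    Continuous (cutNorm : Matrix V W ℝ → ℝ) := by
  unfold cutNorm
  refine Continuous.finset_sup'_apply _ fun p _ => ?_
  fun_prop

theorem DSStar_nonempty (V W : Type*) [Fintype V] [Fintype W] [Nonempty V] [Nonempty W] :
    (DSStar V W).Nonempty := by
  have hV : (Fintype.card V : ℝ) ≠ 0 := by exact_mod_cast Fintype.card_ne_zero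
  have hW : (Fintype.card W : ℝ) ≠ 0 := by exact_mod_cast Fintype.card_ne_zero
  refine ⟨fun _ _ => 1 / ((Fintype.card V : ℝ) * Fintype.card W), fun _ _ => by positivity,
    fun v => ?_, fun w => ?_⟩
  · simp only [Finset.sum_const, Finset.card_univ, nsmul_eq_mul]
    field_simp
  · simp only [Finset.sum_const, Finset.card_univ, nsmul_eq_mul]
    field_simp

theorem isCompact_DSStar (V W : Type*) [Fintype V] [Fintype W] : IsCompact (DSStar V W) := by
  have hsub : DSStar V W ⊆ Set.univ.pi fun _ : V => Set.univ.pi fun _ : W =>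
      Set.Icc (0 : ℝ) (1 / (Fintype.card V : ℝ)) := by
    intro Q hQ v _ w _
    refine ⟨hQ.1 v w, ?_⟩
    rw [← hQ.2.1 v]
    exact Finset.single_le_sum (f := fun w => Q v w) (fun w _ => hQ.1 v w) (Finset.mem_univ w)
  have hK : IsCompact (Set.univ.pi fun _ : V => Set.univ.pi fun _ : W =>
      Set.Icc (0 : ℝ) (1 / (Fintype.card V : ℝ))) :=
    isCompact_univ_pi fun _ => isCompact_univ_pi fun _ => isCompact_Icc
  refine hK.of_isClosed_subset ?_ hsub
  have h1 : IsClosed {Q : V → W → ℝ | ∀ v w, 0 ≤ Q v w} := by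
    simp only [Set.ofPred_forall]
    exact isClosed_iInter fun v => isClosed_iInter fun w =>
      isClosed_le continuous_const (by fun_prop)
  have h2 : IsClosed {Q : V → W → ℝ | ∀ v, ∑ w, Q v w = 1 / (Fintype.card V : ℝ)} := by
    simp only [Set.ofPred_forall]
    exact isClosed_iInter fun v => isClosed_eq (by fun_prop) continuous_const
  have h3 : IsClosed {Q : V → W → ℝ | ∀ w, ∑ v, Q v w = 1 / (Fintype.card W : ℝ)} := by
    simp only [Set.ofPred_forall]
    exact isClosed_iInter fun v => isClosed_eq (by fun_prop) continuous_const
  exact h1.inter (h2.inter h3)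

/-- The infimum in `fractionalDist` is a minimum. -/
theorem fractionalDist_isLeast {V W : Type*} [Fintype V] [Fintype W] [Nonempty V] [Nonempty W]
    {N : Matrix V W ℝ → ℝ} (hN : Continuous N) (G : SimpleGraph V) (H : SimpleGraph W)
    [DecidableRel G.Adj] [DecidableRel H.Adj] :
    IsLeast ((fun Q => N (discrepancy G H Q)) '' DSStar V W) (fractionalDist N G H) := by
  have hc : Continuous fun Q : Matrix V W ℝ => N (discrepancy G H Q) := by
    refine hN.comp ?_
    unfold discrepancy
    fun_prop
  exact ((isCompact_DSStar V W).image hc).isLeast_sInf ((DSStar_nonempty V W).image _)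

theorem homDensity_mem_Icc {U V : Type*} [Fintype U] [Fintype V]
    (F : SimpleGraph U) (G : SimpleGraph V) : homDensity F G ∈ Set.Icc (0 : ℝ) 1 := by
  classical
  refine ⟨by unfold homDensity; positivity, ?_⟩
  have h : Nat.card (F →g G) ≤ Fintype.card V ^ Fintype.card U := by
    rw [← Fintype.card_fun, ← Nat.card_eq_fintype_card]
    exact Nat.card_le_card_of_injective (fun f : F →g G => (f : U → V)) DFunLike.coe_injective
  exact div_le_one_of_le₀ (by exact_mod_cast h) (by positivity)

/-- The series in `homDensityDist` converges. -/
theorem summable_homDensityTerm {V W : Type*} [Fintype V] [Fintype W]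
    (𝓕 : (k : ℕ) → Set (SimpleGraph (Fin k))) (G : SimpleGraph V) (H : SimpleGraph W) :
    Summable (homDensityTerm 𝓕 G H) := by
  refine Summable.of_nonneg_of_le (fun k => ?_) (fun k => ?_) summable_geometric_two
  · unfold homDensityTerm
    positivity
  · have hs : ∑ F ∈ members 𝓕 k, (homDensity F G - homDensity F H) ^ 2 ≤
        ((members 𝓕 k).card : ℝ) := by
      refine (Finset.sum_le_card_nsmul _ _ 1 fun F _ => ?_).trans (by simp)
      have hG := homDensity_mem_Icc F G
      have hH := homDensity_mem_Icc F H
      rw [sq_le_one_iff_abs_le_one, abs_le]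
      constructor <;> linarith [hG.1, hG.2, hH.1, hH.2]
    unfold homDensityTerm
    rcases (members 𝓕 k).eq_empty_or_nonempty with h0 | h0
    · simp [h0]
    · have hpos : (0 : ℝ) < (members 𝓕 k).card := by exact_mod_cast h0.card_pos
      calc 1 / (2 ^ k * ((members 𝓕 k).card : ℝ)) *
            ∑ F ∈ members 𝓕 k, (homDensity F G - homDensity F H) ^ 2
          ≤ 1 / (2 ^ k * ((members 𝓕 k).card : ℝ)) * ((members 𝓕 k).card : ℝ) := by gcongr
        _ = (1 / 2) ^ k := by
          rw [div_pow, one_pow]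
          field_simp

end

end GraphDistance

/-! All three distances vanish exactly when some `Q` in `DSStar V W` satisfies `discrepancy G H Q =
0`. For the fractional distances this holds because the minimum is attained and both norms are
definite; the content is the equivalence with equal tree densities.

From `Q` to trees: call `f` and `g` related if `f v = g w` wherever `Q v w ≠ 0`. Related pairs are
closed under products, have equal means and, by the equality case of Jensen
(`mul_eq_mul_of_mulVec_eq`), are closed under neighbourhood means. Stripping a leaf multiplies its
neighbour's weight by a neighbourhood mean, so induction on the tree (`homMean_prod_eq`) gives equal
densities.

From trees to `Q`: `treeAlgebra` collects the functions on `V ⊕ W` usable as vertex weights without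
telling `G` from `H`. It is closed under neighbourhood means, since these amount to attaching a
leaf, and its members have equal means on both sides. It contains the indicators of the classes it
does not separate (`classIndicator_mem`), so each class fills the same fraction of `V` and of `W`.
These classes behave like a common equitable partition, and `Q` spreads mass uniformly inside each
class. -/

namespace GraphDistance

noncomputable section

/-! ### Weighted homomorphism sums and attached leaves -/

section Mean

variable {V : Type*} [Fintype V]

/-- The average of a function on a finite type. -/
def mean (f : V → ℝ) : ℝ := (∑ v, f v) / Fintype.card V

/-- The sum of `f` over the neighbours of a vertex, divided by the number of all vertices. -/
def neighborMean (G : SimpleGraph V) [DecidableRel G.Adj] (f : V → ℝ) (v : V) : ℝ :=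
  (∑ u, G.adjMatrix ℝ v u * f u) / Fintype.card V

open Classical in
/-- The sum of `X φ` over all homomorphisms `φ` from `F` to `G`, divided by the number of all maps
between the vertex sets. -/
def homMean {U : Type*} [Fintype U] (F : SimpleGraph U) (G : SimpleGraph V)
    (X : (U → V) → ℝ) : ℝ :=
  (∑ φ : U → V, if ∀ a b, F.Adj a b → G.Adj (φ a) (φ b) then X φ else 0) /
    (Fintype.card V : ℝ) ^ Fintype.card U

/-- The graph obtained from `F` by attaching a leaf `none` to the vertex `p`. -/
def addLeaf {U : Type*} (F : SimpleGraph U) (p : U) : SimpleGraph (Option U) :=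
  F.map Function.Embedding.some ⊔ SimpleGraph.edge none (some p)

theorem addLeaf_adj_some {U : Type*} (F : SimpleGraph U) (p a b : U) :
    (addLeaf F p).Adj (some a) (some b) ↔ F.Adj a b := by
  simpa [addLeaf, SimpleGraph.edge_adj, SimpleGraph.map_adj'] using fun h : F.Adj a b => h.ne

theorem addLeaf_adj_none_some {U : Type*} (F : SimpleGraph U) (p b : U) :
    (addLeaf F p).Adj none (some b) ↔ b = p := by
  simp [addLeaf, SimpleGraph.edge_adj, SimpleGraph.map_adj', eq_comm]

theorem isTree_addLeaf {U : Type*} [Finite U] {F : SimpleGraph U} (hF : F.IsTree) (p : U) :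
    (addLeaf F p).IsTree := by
  rw [SimpleGraph.isTree_iff_connected_and_card] at hF ⊢
  obtain ⟨hc, hn⟩ := hF
  refine ⟨?_, ?_⟩
  · rw [SimpleGraph.connected_iff_exists_forall_reachable]
    refine ⟨some p, fun x => ?_⟩
    cases x with
    | none =>
      exact ((addLeaf_adj_none_some F p p).2 rfl).symm.reachable
    | some a =>
      let i : F →g addLeaf F p := ⟨some, fun {a b} h => (addLeaf_adj_some F p a b).2 h⟩
      exact (hc.preconnected p a).map i
  · have he : (addLeaf F p).edgeSet =
        insert s(none, some p) (Sym2.map some '' F.edgeSet) := by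
      rw [addLeaf, SimpleGraph.edgeSet_sup, SimpleGraph.edgeSet_edge_of_ne (by simp),
        SimpleGraph.edgeSet_map, Set.union_comm]
      rfl
    have hnot : s(none, some p) ∉ Sym2.map some '' F.edgeSet := by
      rintro ⟨e, -, h⟩
      induction e with
      | _ a b => simp at h
    rw [Nat.card_coe_set_eq, he, Set.ncard_insert_of_notMem hnot (Set.toFinite _),
      Set.ncard_image_of_injective _ (Sym2.map.injective (Option.some_injective U)),
      ← Nat.card_coe_set_eq, hn, Finite.card_option]

theorem homMean_one {U : Type*} [Fintype U] (F : SimpleGraph U) (G : SimpleGraph V) :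
    homMean F G (fun _ => 1) = homDensity F G := by
  classical
  unfold homMean homDensity
  congr 1
  rw [Finset.sum_boole]
  norm_cast
  rw [← Fintype.card_subtype, ← Nat.card_eq_fintype_card]
  exact Nat.card_congr
    ⟨fun φ => ⟨φ.1, fun {a b} h => φ.2 a b h⟩, fun φ => ⟨φ, fun a b h => φ.map_rel h⟩,
      fun _ => rfl, fun _ => rfl⟩

theorem homMean_comap {U U' : Type*} [Fintype U] [Fintype U'] (e : U' ≃ U) (F : SimpleGraph U)
    (G : SimpleGraph V) (X : (U → V) → ℝ) :
    homMean (F.comap e) G (fun φ => X (φ ∘ e.symm)) = homMean F G X := by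
  classical
  unfold homMean
  rw [Fintype.card_congr e]
  congr 1
  refine Fintype.sum_equiv (e.arrowCongr (Equiv.refl V)) _ _ fun φ => ?_
  have h : (∀ a b, (F.comap e).Adj a b → G.Adj (φ a) (φ b)) ↔
      ∀ a b, F.Adj a b → G.Adj (φ (e.symm a)) (φ (e.symm b)) := by
    refine ⟨fun h a b hab => h _ _ (by simpa using hab), fun h a b hab => ?_⟩
    simpa using h _ _ hab
  simp only [h]
  rfl

theorem homMean_add {U : Type*} [Fintype U] (F : SimpleGraph U) (G : SimpleGraph V)
    (X Y : (U → V) → ℝ) :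
    homMean F G (fun φ => X φ + Y φ) = homMean F G X + homMean F G Y := by
  unfold homMean
  rw [← add_div, ← Finset.sum_add_distrib]
  congr 1
  refine Finset.sum_congr rfl fun φ _ => ?_
  split_ifs <;> simp

theorem homMean_const_mul {U : Type*} [Fintype U] (F : SimpleGraph U) (G : SimpleGraph V)
    (c : ℝ) (X : (U → V) → ℝ) :
    homMean F G (fun φ => c * X φ) = c * homMean F G X := by
  unfold homMean
  rw [← mul_div_assoc, Finset.mul_sum]
  congr 1
  refine Finset.sum_congr rfl fun φ _ => ?_
  split_ifs <;> simp

theorem homMean_of_unique {U : Type*} [Fintype U] [Unique U] (F : SimpleGraph U)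
    (G : SimpleGraph V) (f : V → ℝ) : homMean F G (fun φ => f (φ default)) = mean f := by
  classical
  unfold homMean mean
  rw [Fintype.card_unique (α := U), pow_one]
  congr 1
  refine @Fintype.sum_equiv _ _ _ (_) (_) _ (Equiv.funUnique U V) _ _ fun φ => ?_
  rw [if_pos]
  · rfl
  · intro a b h
    exact absurd (Subsingleton.elim a b) h.ne

theorem homMean_addLeaf {U : Type*} [Fintype U] (F : SimpleGraph U) (p : U) (G : SimpleGraph V)
    [DecidableRel G.Adj] (X : (U → V) → ℝ) (f : V → ℝ) :
    homMean (addLeaf F p) G (fun φ => X (φ ∘ some) * f (φ none)) =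
      homMean F G (fun φ => X φ * neighborMean G f (φ p)) := by
  classical
  have hom_iff : ∀ φ : Option U → V, (∀ a b, (addLeaf F p).Adj a b → G.Adj (φ a) (φ b)) ↔
      (∀ a b, F.Adj a b → G.Adj (φ (some a)) (φ (some b))) ∧ G.Adj (φ (some p)) (φ none) := by
    intro φ
    constructor
    · intro h
      exact ⟨fun a b hab => h _ _ ((addLeaf_adj_some F p a b).2 hab),
        h _ _ ((addLeaf_adj_none_some F p p).2 rfl).symm⟩
    · rintro ⟨h1, h2⟩ (_ | a) (_ | b) h
      · exact absurd rfl h.ne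
      · rw [addLeaf_adj_none_some] at h
        exact h ▸ h2.symm
      · rw [SimpleGraph.adj_comm, addLeaf_adj_none_some] at h
        exact h ▸ h2
      · exact h1 a b ((addLeaf_adj_some F p a b).1 h)
  unfold homMean
  -- The extra vertex contributes one more factor `|V|` to the denominator, which is the
  -- normalisation in `neighborMean`.
  rw [Fintype.card_option, pow_succ', ← div_div]
  congr 1
  rw [Finset.sum_div]
  refine (@Fintype.sum_equiv _ _ _ (_) inferInstance _
    (Equiv.piOptionEquivProd (β := fun _ : Option U => V)) _ (fun x : V × (U → V) => (if (∀ a b, F.Adj a b → G.Adj (x.2 a) (x.2 b)) ∧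
      G.Adj (x.2 p) x.1 then X x.2 * f x.1 else 0) / (Fintype.card V : ℝ)) ?_).trans ?_
  rotate_left
  · rw [Fintype.sum_prod_type_right]
    refine Finset.sum_congr rfl fun ψ _ => ?_
    by_cases h : ∀ a b, F.Adj a b → G.Adj (ψ a) (ψ b)
    · rw [if_pos h]
      simp only [neighborMean]
      rw [← Finset.sum_div, ← mul_div_assoc, Finset.mul_sum]
      congr 1
      refine Finset.sum_congr rfl fun v _ => ?_
      simp only [SimpleGraph.adjMatrix_apply, and_iff_right h]
      split_ifs <;> simp
    · simp [h]
  · intro φ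
    simp only [hom_iff]
    rfl

theorem sum_mul_neighborMean_comm (G : SimpleGraph V) [DecidableRel G.Adj] (f g : V → ℝ) :
    ∑ v, f v * neighborMean G g v = ∑ v, neighborMean G f v * g v := by
  simp only [neighborMean, ← mul_div_assoc, div_mul_eq_mul_div, Finset.mul_sum, Finset.sum_mul,
    ← Finset.sum_div]
  congr 1
  rw [Finset.sum_comm]
  refine Finset.sum_congr rfl fun v _ => Finset.sum_congr rfl fun u _ => ?_
  simp only [SimpleGraph.adjMatrix_apply, G.adj_comm u v]
  ring

end Mean

/-! ### Induction on trees by leaf removal -/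

section LeafRemoval

variable {V W : Type*} [Fintype V] [Fintype W] {G : SimpleGraph V} {H : SimpleGraph W}
  [DecidableRel G.Adj] [DecidableRel H.Adj]

/-- A tree with at least two vertices arises by attaching a leaf to a tree. -/
theorem exists_comap_eq_addLeaf {U : Type*} [Finite U] [Nontrivial U] {F : SimpleGraph U}
    (hF : F.IsTree) : ∃ (ℓ : U) (F' : SimpleGraph {u // u ≠ ℓ}) (p : {u // u ≠ ℓ})
      (e : Option {u // u ≠ ℓ} ≃ U), F'.IsTree ∧ F.comap e = addLeaf F' p := by
  classical
  have := Fintype.ofFinite U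
  obtain ⟨ℓ, hℓ⟩ := hF.exists_vert_degree_one_of_nontrivial
  obtain ⟨p, hp, hp'⟩ := SimpleGraph.degree_eq_one_iff_existsUnique_adj.1 hℓ
  refine ⟨ℓ, F.comap Subtype.val, ⟨p, hp.ne'⟩, Equiv.optionSubtypeNe ℓ,
    ⟨hF.connected.induce_compl_singleton_of_degree_eq_one hℓ,
      hF.isAcyclic.of_comap (Function.Embedding.subtype _)⟩, ?_⟩
  have key : ∀ b : {u // u ≠ ℓ}, F.Adj ℓ b ↔ b = ⟨p, hp.ne'⟩ := by
    intro b
    rw [Subtype.ext_iff]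
    exact ⟨fun h => hp' _ h, fun h => by rw [h]; exact hp⟩
  ext a b
  cases a with
  | none =>
    cases b with
    | none => simp
    | some b => simp [addLeaf_adj_none_some, key]
  | some a =>
    cases b with
    | none =>
      rw [SimpleGraph.adj_comm, SimpleGraph.adj_comm (addLeaf _ _)]
      simp [addLeaf_adj_none_some, key]
    | some b => simp [addLeaf_adj_some]

open Classical in
/-- Removing a leaf from the sum of a product of vertex weights changes the weight of its
neighbour. -/
theorem homMean_prod_of_comap_eq_addLeaf {U U' : Type*} [Fintype U] [Fintype U']
    {F : SimpleGraph U} {F' : SimpleGraph U'} {p : U'} (e : Option U' ≃ U)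
    (he : F.comap e = addLeaf F' p) (G : SimpleGraph V) [DecidableRel G.Adj] (x : U → V → ℝ) :
    homMean F G (fun φ => ∏ u, x u (φ u)) = homMean F' G (fun φ => ∏ u, (if u = p then
      fun v => x (e (some u)) v * neighborMean G (x (e none)) v else x (e (some u))) (φ u)) := by
  rw [← homMean_comap e, he]
  have h : ∀ φ : Option U' → V, ∏ u, x u ((φ ∘ e.symm) u) =
      (fun ψ : U' → V => ∏ u, x (e (some u)) (ψ u)) (φ ∘ some) * x (e none) (φ none) := by
    intro φ
    rw [← e.prod_comp, Fintype.prod_option, mul_comm]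
    simp
  simp only [h]
  rw [homMean_addLeaf F' p G (fun ψ => ∏ u, x (e (some u)) (ψ u))]
  congr 1
  funext ψ
  rw [← Finset.mul_prod_erase _ _ (Finset.mem_univ p),
    ← Finset.mul_prod_erase _ _ (Finset.mem_univ p), if_pos rfl, mul_right_comm]
  congr 1
  refine Finset.prod_congr rfl fun u hu => ?_
  rw [if_neg (Finset.ne_of_mem_erase hu)]

/-- If a class `R` of pairs of functions on the vertices of `G` and `H` is closed under products
and neighbourhood means, and consists of pairs with equal means, then tree homomorphism sums with
vertex weights from `R` agree. -/
theorem homMean_prod_eq (R : (V → ℝ) → (W → ℝ) → Prop)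
    (hmul : ∀ f g f' g', R f g → R f' g' → R (fun v => f v * f' v) fun w => g w * g' w)
    (hnbr : ∀ f g, R f g → R (neighborMean G f) (neighborMean H g))
    (hmean : ∀ f g, R f g → mean f = mean g) (n : ℕ) :
    ∀ (U : Type) [Fintype U] (F : SimpleGraph U), F.IsTree → Fintype.card U = n →
      ∀ (x : U → V → ℝ) (y : U → W → ℝ), (∀ u, R (x u) (y u)) →
        homMean F G (fun φ => ∏ u, x u (φ u)) = homMean F H (fun φ => ∏ u, y u (φ u)) := by
  classical
  induction n with
  | zero =>
    intro U _ F hF hU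
    have := hF.connected.nonempty
    exact absurd hU Fintype.card_ne_zero
  | succ n ih =>
    intro U _ F hF hU x y hxy
    have hne := hF.connected.nonempty
    rcases subsingleton_or_nontrivial U with hs | hs
    · obtain ⟨hu⟩ : Nonempty (Unique U) := ⟨@Unique.mk' U ⟨hne.some⟩ hs⟩
      simp only [Fintype.prod_unique]
      rw [homMean_of_unique, homMean_of_unique]
      exact hmean _ _ (hxy _)
    · obtain ⟨ℓ, F', p, e, hF', he⟩ := exists_comap_eq_addLeaf hF
      have hcard : Fintype.card {u // u ≠ ℓ} = n := by
        have := Fintype.card_congr e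
        rw [Fintype.card_option] at this
        omega
      rw [homMean_prod_of_comap_eq_addLeaf e he G x, homMean_prod_of_comap_eq_addLeaf e he H y]
      refine ih _ F' hF' hcard _ _ fun u => ?_
      split_ifs
      · exact hmul _ _ _ _ (hxy _) (hnbr _ _ (hxy _))
      · exact hxy _

end LeafRemoval
-- From an intertwiner to equal tree densities
section Transport

variable {V W : Type*} [Fintype V] [Fintype W] {G : SimpleGraph V} {H : SimpleGraph W}
  [DecidableRel G.Adj] [DecidableRel H.Adj]

theorem neighborMean_eq_mulVec (G : SimpleGraph V) [DecidableRel G.Adj] (f : V → ℝ) :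
    neighborMean G f = (1 / (Fintype.card V : ℝ)) • (G.adjMatrix ℝ).mulVec f := by
  funext v
  simp [neighborMean, Matrix.mulVec, dotProduct, div_eq_inv_mul]

theorem neighborMean_eq_vecMul (G : SimpleGraph V) [DecidableRel G.Adj] (f : V → ℝ) :
    neighborMean G f = (1 / (Fintype.card V : ℝ)) • Matrix.vecMul f (G.adjMatrix ℝ) := by
  rw [neighborMean_eq_mulVec, ← Matrix.vecMul_transpose, SimpleGraph.transpose_adjMatrix]

/-- Jensen's equality case: if `Q` maps `g` to `f` and its transpose maps `f` to `g`, up to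
normalisation, then `f` and `g` agree along the support of `Q`. -/
theorem mul_eq_mul_of_mulVec_eq {Q : Matrix V W ℝ} (hQ : Q ∈ DSStar V W) {f : V → ℝ} {g : W → ℝ}
    (hf : Q.mulVec g = (1 / (Fintype.card V : ℝ)) • f)
    (hg : Matrix.vecMul f Q = (1 / (Fintype.card W : ℝ)) • g) (v : V) (w : W) :
    Q v w * f v = Q v w * g w := by
  have h1 : ∑ v, ∑ w, Q v w * f v ^ 2 = ∑ v, ∑ w, Q v w * (f v * g w) := by
    refine Finset.sum_congr rfl fun v _ => ?_
    have h := congrFun hf v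
    simp only [Matrix.mulVec, dotProduct, Pi.smul_apply, smul_eq_mul] at h
    rw [← Finset.sum_mul, hQ.2.1 v, sq, ← mul_assoc, ← h, Finset.sum_mul]
    exact Finset.sum_congr rfl fun w _ => by ring
  have h2 : ∑ v, ∑ w, Q v w * g w ^ 2 = ∑ v, ∑ w, Q v w * (f v * g w) := by
    rw [Finset.sum_comm, Finset.sum_comm (f := fun v w => Q v w * (f v * g w))]
    refine Finset.sum_congr rfl fun w _ => ?_
    have h := congrFun hg w
    simp only [Matrix.vecMul, dotProduct, Pi.smul_apply, smul_eq_mul] at h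
    rw [← Finset.sum_mul, hQ.2.2 w, sq, ← mul_assoc, ← h, Finset.sum_mul]
    exact Finset.sum_congr rfl fun w _ => by ring
  -- Both sums of squares equal the mixed sum, so the expanded square cancels; its nonnegative terms
  -- then vanish one by one.
  have h3 : ∑ v, ∑ w, Q v w * (f v - g w) ^ 2 = 0 := by
    have : ∑ v, ∑ w, Q v w * (f v - g w) ^ 2 = ∑ v, ∑ w, Q v w * f v ^ 2 +
        ∑ v, ∑ w, Q v w * g w ^ 2 - 2 * ∑ v, ∑ w, Q v w * (f v * g w) := by
      simp only [Finset.mul_sum, ← Finset.sum_add_distrib, ← Finset.sum_sub_distrib]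
      exact Finset.sum_congr rfl fun v _ => Finset.sum_congr rfl fun w _ => by ring
    rw [this, h1, h2]
    ring
  have hnn : ∀ v w, 0 ≤ Q v w * (f v - g w) ^ 2 := fun v w => mul_nonneg (hQ.1 v w) (sq_nonneg _)
  rw [Finset.sum_eq_zero_iff_of_nonneg fun v _ => Finset.sum_nonneg fun w _ => hnn v w] at h3
  have h4 := h3 v (Finset.mem_univ v)
  rw [Finset.sum_eq_zero_iff_of_nonneg fun w _ => hnn v w] at h4
  rcases mul_eq_zero.1 (h4 w (Finset.mem_univ w)) with h | h
  · simp [h]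
  · rw [sub_eq_zero.1 (pow_eq_zero_iff two_ne_zero |>.1 h)]

theorem mulVec_eq_of_mul_eq_mul {Q : Matrix V W ℝ} (hQ : Q ∈ DSStar V W) {f : V → ℝ} {g : W → ℝ}
    (h : ∀ v w, Q v w * f v = Q v w * g w) : Q.mulVec g = (1 / (Fintype.card V : ℝ)) • f := by
  funext v
  simp only [Matrix.mulVec, dotProduct, Pi.smul_apply, smul_eq_mul, ← h]
  rw [← Finset.sum_mul, hQ.2.1 v]

theorem vecMul_eq_of_mul_eq_mul {Q : Matrix V W ℝ} (hQ : Q ∈ DSStar V W) {f : V → ℝ} {g : W → ℝ}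
    (h : ∀ v w, Q v w * f v = Q v w * g w) :
    Matrix.vecMul f Q = (1 / (Fintype.card W : ℝ)) • g := by
  funext w
  simp only [Matrix.vecMul, dotProduct, Pi.smul_apply, smul_eq_mul, mul_comm (f _), h]
  rw [← Finset.sum_mul, hQ.2.2 w]

/-- If `Q` intertwines the normalised adjacency matrices, then agreement along the support of `Q`
is preserved by neighbourhood means. -/
theorem mul_neighborMean_eq {Q : Matrix V W ℝ} (hQ : Q ∈ DSStar V W)
    (hd : discrepancy G H Q = 0) {f : V → ℝ} {g : W → ℝ}
    (h : ∀ v w, Q v w * f v = Q v w * g w) (v : V) (w : W) :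
    Q v w * neighborMean G f v = Q v w * neighborMean H g w := by
  have hd' : (1 / (Fintype.card V : ℝ)) • (G.adjMatrix ℝ * Q) =
      (1 / (Fintype.card W : ℝ)) • (Q * H.adjMatrix ℝ) := sub_eq_zero.1 hd
  -- Intertwining moves `Q` past the adjacency matrix, after which `Q` turns `g` into a multiple of
  -- `f`, or its transpose `f` into a multiple of `g`.
  refine mul_eq_mul_of_mulVec_eq hQ ?_ ?_ v w
  · rw [neighborMean_eq_mulVec H, Matrix.mulVec_smul, Matrix.mulVec_mulVec, ← Matrix.smul_mulVec,
      ← hd', Matrix.smul_mulVec, ← Matrix.mulVec_mulVec, mulVec_eq_of_mul_eq_mul hQ h,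
      Matrix.mulVec_smul, ← neighborMean_eq_mulVec]
  · rw [neighborMean_eq_vecMul G, Matrix.smul_vecMul, Matrix.vecMul_vecMul, ← Matrix.vecMul_smul,
      hd', Matrix.vecMul_smul, ← Matrix.vecMul_vecMul, vecMul_eq_of_mul_eq_mul hQ h,
      Matrix.smul_vecMul, ← neighborMean_eq_vecMul]

theorem mean_eq_of_mul_eq_mul {Q : Matrix V W ℝ} (hQ : Q ∈ DSStar V W) {f : V → ℝ} {g : W → ℝ}
    (h : ∀ v w, Q v w * f v = Q v w * g w) : mean f = mean g := by
  have h1 : mean f = ∑ v, ∑ w, Q v w * f v := by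
    simp only [mean, ← Finset.sum_mul, hQ.2.1, Finset.sum_div]
    exact Finset.sum_congr rfl fun v _ => by ring
  have h2 : mean g = ∑ v, ∑ w, Q v w * g w := by
    rw [Finset.sum_comm]
    simp only [mean, ← Finset.sum_mul, hQ.2.2, Finset.sum_div]
    exact Finset.sum_congr rfl fun v _ => by ring
  rw [h1, h2]
  simp only [h]

/-- A doubly stochastic intertwiner forces equal tree densities. -/
theorem homDensity_eq_of_discrepancy_eq_zero {Q : Matrix V W ℝ} (hQ : Q ∈ DSStar V W)
    (hd : discrepancy G H Q = 0) {U : Type} [Fintype U] {F : SimpleGraph U} (hF : F.IsTree) :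
    homDensity F G = homDensity F H := by
  have := homMean_prod_eq (G := G) (H := H) (fun f g => ∀ v w, Q v w * f v = Q v w * g w)
    (fun f g f' g' h h' v w => by rw [← mul_assoc, h, mul_right_comm, h', mul_right_comm, mul_assoc])
    (fun f g h => mul_neighborMean_eq hQ hd h) (fun f g h => mean_eq_of_mul_eq_mul hQ h) _ U F hF rfl
    (fun _ _ => 1) (fun _ _ => 1) (fun _ _ _ => rfl)
  simpa only [Finset.prod_const_one, homMean_one] using this

end Transport

/-! ### The algebra of weights invisible to trees -/

section TreeAlgebra

variable {V W : Type*} [Fintype V] [Fintype W]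

/-- Functions of maps `U → V` and `U → W` that give equal sums over the homomorphisms from any tree
in which the elements of `U` mark vertices. -/
def TreeIndistinguishable (G : SimpleGraph V) (H : SimpleGraph W) {U : Type}
    (X : (U → V) → ℝ) (Y : (U → W) → ℝ) : Prop :=
  ∀ (T : Type) [Fintype T] (F : SimpleGraph T), F.IsTree → ∀ i : U → T,
    homMean F G (fun φ => X (φ ∘ i)) = homMean F H (fun φ => Y (φ ∘ i))

/-- The algebra of vertex functions multiplication by which preserves `TreeIndistinguishable`. -/
def treeAlgebra (G : SimpleGraph V) (H : SimpleGraph W) : Subalgebra ℝ (V ⊕ W → ℝ) where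
  -- Quantifying over every `U` and every pair makes products a matter of applying the condition
  -- twice, and lets new marks be introduced.
  carrier := {h | ∀ (U : Type) (X : (U → V) → ℝ) (Y : (U → W) → ℝ), TreeIndistinguishable G H X Y →
    ∀ u, TreeIndistinguishable G H (fun φ => X φ * h (Sum.inl (φ u)))
      (fun φ => Y φ * h (Sum.inr (φ u)))}
  mul_mem' := by
    intro a b ha hb U X Y hXY u
    have h := hb U _ _ (ha U X Y hXY u) u
    simpa only [Pi.mul_apply, mul_assoc] using h
  add_mem' := by
    intro a b ha hb U X Y hXY u T _ F hF i
    simp only [Pi.add_apply, mul_add]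
    rw [homMean_add, homMean_add, ha U X Y hXY u T F hF i, hb U X Y hXY u T F hF i]
  algebraMap_mem' := by
    intro r U X Y hXY u T _ F hF i
    simp only [Pi.algebraMap_apply, Algebra.algebraMap_self, RingHom.id_apply, mul_comm _ r]
    rw [homMean_const_mul, homMean_const_mul, hXY T F hF i]

variable {G : SimpleGraph V} {H : SimpleGraph W} [DecidableRel G.Adj] [DecidableRel H.Adj]

/-- Weighting a marked vertex by a neighbourhood mean of `h` is the same as attaching a leaf there
and weighting the leaf by `h`; the larger graph is still a tree. -/
theorem neighborMean_mem_treeAlgebra {h : V ⊕ W → ℝ} (hh : h ∈ treeAlgebra G H) :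
    Sum.elim (neighborMean G (h ∘ Sum.inl)) (neighborMean H (h ∘ Sum.inr)) ∈ treeAlgebra G H := by
  intro U X Y hXY u T _ F hF i
  have h1 : TreeIndistinguishable G H (fun φ : Option U → V => X (φ ∘ some))
      (fun φ : Option U → W => Y (φ ∘ some)) :=
    fun T _ F hF i => hXY T F hF (i ∘ some)
  -- The extra mark `none` sits on the new leaf.
  have h2 := hh (Option U) _ _ h1 none (Option T) (addLeaf F (i u)) (isTree_addLeaf hF _)
    (Option.map i)
  have h3 := homMean_addLeaf F (i u) G (fun φ => X (φ ∘ i)) (h ∘ Sum.inl)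
  have h4 := homMean_addLeaf F (i u) H (fun φ => Y (φ ∘ i)) (h ∘ Sum.inr)
  exact h3.symm.trans (h2.trans h4)

-- Equal tree densities say that the constant pair `1`, `1` is indistinguishable; multiplying it by
-- `h` and testing on the one-vertex tree compares means.
omit [DecidableRel G.Adj] [DecidableRel H.Adj] in
theorem mean_eq_of_mem_treeAlgebra
    (ht : ∀ (k : ℕ) (F : SimpleGraph (Fin k)), F.IsTree → homDensity F G = homDensity F H)
    {h : V ⊕ W → ℝ} (hh : h ∈ treeAlgebra G H) : mean (h ∘ Sum.inl) = mean (h ∘ Sum.inr) := by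
  have h1 : TreeIndistinguishable G H (U := Unit) (fun _ => 1) (fun _ => 1) := by
    intro T _ F hF i
    let e := (Fintype.equivFin T).symm
    rw [← homMean_comap e F G, ← homMean_comap e F H, homMean_one, homMean_one]
    exact ht _ _ ((SimpleGraph.Iso.comap e F).isTree_iff.2 hF)
  have h2 := hh Unit _ _ h1 () Unit ⊥ SimpleGraph.IsTree.of_subsingleton id
  simp only [one_mul] at h2
  have h3 := homMean_of_unique (⊥ : SimpleGraph Unit) G (h ∘ Sum.inl)
  have h4 := homMean_of_unique (⊥ : SimpleGraph Unit) H (h ∘ Sum.inr)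
  exact h3.symm.trans (h2.trans h4)

end TreeAlgebra

/-! ### Classes of a function algebra on a finite set -/

section Separation

variable {Z : Type*} [Fintype Z] (𝒜 : Subalgebra ℝ (Z → ℝ))

open Classical in
/-- The indicator function of the set of points that a subalgebra does not separate from `x`. -/
def classIndicator (x y : Z) : ℝ := if ∀ h ∈ 𝒜, h x = h y then 1 else 0

omit [Fintype Z] in
theorem classIndicator_nonneg (x y : Z) : 0 ≤ classIndicator 𝒜 x y := by
  unfold classIndicator
  split_ifs <;> simp

omit [Fintype Z] in
theorem classIndicator_self (x : Z) : classIndicator 𝒜 x x = 1 := by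
  simp [classIndicator]

omit [Fintype Z] in
theorem classIndicator_comm (x y : Z) : classIndicator 𝒜 x y = classIndicator 𝒜 y x := by
  unfold classIndicator
  congr 1
  exact propext (forall₂_congr fun h _ => eq_comm)

omit [Fintype Z] in
theorem classIndicator_mul_apply {h : Z → ℝ} (hh : h ∈ 𝒜) (x y : Z) :
    classIndicator 𝒜 x y * h y = classIndicator 𝒜 x y * h x := by
  unfold classIndicator
  split_ifs with hxy
  · rw [hxy h hh]
  · simp

omit [Fintype Z] in
theorem classIndicator_congr {x y : Z} (hxy : classIndicator 𝒜 x y ≠ 0) :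
    classIndicator 𝒜 x = classIndicator 𝒜 y := by
  have h : ∀ h ∈ 𝒜, h x = h y := by
    by_contra hc
    exact hxy (if_neg hc)
  funext z
  unfold classIndicator
  congr 1
  exact propext (forall₂_congr fun a ha => by rw [h a ha])

/-- Indicators of the classes of a subalgebra of functions on a finite set belong to it. -/
theorem classIndicator_mem (x : Z) : classIndicator 𝒜 x ∈ 𝒜 := by
  classical
  have hsep : ∀ y, ∃ h ∈ 𝒜, h x = 1 ∧ (classIndicator 𝒜 x y = 0 → h y = 0) := by
    intro y
    by_cases hy : ∀ h ∈ 𝒜, h x = h y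
    · exact ⟨1, 𝒜.one_mem, rfl, fun h0 => absurd h0 (by
        rw [classIndicator, if_pos hy]
        exact one_ne_zero)⟩
    · push Not at hy
      obtain ⟨h, hh, hne⟩ := hy
      refine ⟨(h x - h y)⁻¹ • (h - algebraMap ℝ (Z → ℝ) (h y)),
        𝒜.smul_mem (𝒜.sub_mem hh (𝒜.algebraMap_mem _)) _, ?_, fun _ => ?_⟩
      · simp [inv_mul_cancel₀ (sub_ne_zero.2 hne)]
      · simp
  choose f hf hfx hfy using hsep
  -- As in Lagrange interpolation, the factor `f y` is `1` on the class of `x` and vanishes at `y`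
  -- when `y` lies outside it.
  have : classIndicator 𝒜 x = ∏ y, f y := by
    funext z
    rw [Finset.prod_apply]
    by_cases hz : classIndicator 𝒜 x z = 0
    · rw [hz]
      exact (Finset.prod_eq_zero (f := fun y => f y z) (Finset.mem_univ z) (hfy z hz)).symm
    · have hz' : ∀ h ∈ 𝒜, h x = h z := by
        by_contra hc
        exact hz (if_neg hc)
      rw [Finset.prod_eq_one fun y _ => by rw [← hz' _ (hf y), hfx y]]
      exact if_pos hz'
  rw [this]
  exact 𝒜.prod_mem fun y _ => hf y

end Separation

/-! ### From equal tree densities to an intertwiner -/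

section Intertwiner

variable {V W : Type*} [Fintype V] [Fintype W] [Nonempty V] [Nonempty W] {G : SimpleGraph V}
  {H : SimpleGraph W} [DecidableRel G.Adj] [DecidableRel H.Adj]

/-- Equal tree densities give a doubly stochastic matrix that intertwines the normalised adjacency
matrices: it is constant on the blocks of the partition given by `treeAlgebra`. -/
theorem exists_discrepancy_eq_zero
    (ht : ∀ (k : ℕ) (F : SimpleGraph (Fin k)), F.IsTree → homDensity F G = homDensity F H) :
    ∃ Q ∈ DSStar V W, discrepancy G H Q = 0 := by
  set 𝒜 := treeAlgebra G H
  set χ := classIndicator 𝒜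
  have hm : (0 : ℝ) < Fintype.card V := by exact_mod_cast Fintype.card_pos
  have hn : (0 : ℝ) < Fintype.card W := by exact_mod_cast Fintype.card_pos
  -- The fraction of `V` filled by the class of `x`; by `hp` it is also the fraction of `W`.
  let p : V ⊕ W → ℝ := fun x => mean (χ x ∘ Sum.inl)
  have hp : ∀ x, mean (χ x ∘ Sum.inr) = p x := fun x =>
    (mean_eq_of_mem_treeAlgebra ht (classIndicator_mem 𝒜 x)).symm
  have hsumV : ∀ x, ∑ v, χ x (Sum.inl v) = Fintype.card V * p x := fun x => by
    simp only [p, mean, Function.comp_apply]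
    field_simp
  have hsumW : ∀ x, ∑ w, χ x (Sum.inr w) = Fintype.card W * p x := fun x => by
    rw [← hp]
    simp only [mean, Function.comp_apply]
    field_simp
  have hpos : ∀ x, 0 < p x := by
    rintro (v | w)
    · refine pos_of_mul_pos_right ?_ hm.le
      rw [← hsumV]
      exact Finset.sum_pos' (fun _ _ => classIndicator_nonneg _ _ _)
        ⟨v, Finset.mem_univ v, one_pos.trans_eq (classIndicator_self 𝒜 _).symm⟩
    -- The class of `w` visibly meets only `W`, so its fraction is measured there.
    · refine pos_of_mul_pos_right ?_ hn.le
      rw [← hsumW]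
      exact Finset.sum_pos' (fun _ _ => classIndicator_nonneg _ _ _)
        ⟨w, Finset.mem_univ w, one_pos.trans_eq (classIndicator_self 𝒜 _).symm⟩
  let Q : Matrix V W ℝ := fun v w =>
    χ (Sum.inl v) (Sum.inr w) / (Fintype.card V * Fintype.card W * p (Sum.inl v))
  -- `Q` is symmetric in the two sides, because `v` and `w` have the same class wherever it is
  -- nonzero.
  have hQ : ∀ v w, Q v w =
      χ (Sum.inr w) (Sum.inl v) / (Fintype.card V * Fintype.card W * p (Sum.inr w)) := by
    intro v w
    have hc : χ (Sum.inr w) (Sum.inl v) = χ (Sum.inl v) (Sum.inr w) := classIndicator_comm _ _ _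
    by_cases h : χ (Sum.inl v) (Sum.inr w) = 0
    · simp only [Q, hc, h, zero_div]
    · simp only [Q, hc, p, χ, classIndicator_congr 𝒜 h]
  refine ⟨Q, ⟨fun v w => ?_, fun v => ?_, fun w => ?_⟩, ?_⟩
  · have := hpos (Sum.inl v)
    exact div_nonneg (classIndicator_nonneg _ _ _) (by positivity)
  · have := (hpos (Sum.inl v)).ne'
    simp only [Q]
    rw [← Finset.sum_div, hsumW]
    field_simp
  · have := (hpos (Sum.inr w)).ne'
    simp only [hQ]
    rw [← Finset.sum_div, hsumV]
    field_simp
  · ext v w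
    have hv := (hpos (Sum.inl v)).ne'
    have hw := (hpos (Sum.inr w)).ne'
    have hT := neighborMean_mem_treeAlgebra (classIndicator_mem 𝒜 (Sum.inr w))
    have hS := neighborMean_mem_treeAlgebra (classIndicator_mem 𝒜 (Sum.inl v))
    -- Double counting of edges in `H` between the classes of `v` and `w`. Neighbourhood means of
    -- indicators are constant on classes across `V ⊕ W`, which is how a value taken in `G` enters.
    have key : p (Sum.inl v) * neighborMean G (χ (Sum.inr w) ∘ Sum.inl) v =
        p (Sum.inr w) * neighborMean H (χ (Sum.inl v) ∘ Sum.inr) w := by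
      have h := sum_mul_neighborMean_comm H (χ (Sum.inl v) ∘ Sum.inr) (χ (Sum.inr w) ∘ Sum.inr)
      have h1 : ∀ x, (χ (Sum.inl v) ∘ Sum.inr) x *
          neighborMean H (χ (Sum.inr w) ∘ Sum.inr) x =
          χ (Sum.inl v) (Sum.inr x) * neighborMean G (χ (Sum.inr w) ∘ Sum.inl) v :=
        fun x => classIndicator_mul_apply 𝒜 hT (Sum.inl v) (Sum.inr x)
      have h2 : ∀ x, neighborMean H (χ (Sum.inl v) ∘ Sum.inr) x *
          (χ (Sum.inr w) ∘ Sum.inr) x =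
          χ (Sum.inr w) (Sum.inr x) * neighborMean H (χ (Sum.inl v) ∘ Sum.inr) w :=
        fun x => (mul_comm _ _).trans
          (classIndicator_mul_apply 𝒜 hS (Sum.inr w) (Sum.inr x))
      simp only [h1, h2, ← Finset.sum_mul, hsumW, mul_assoc] at h
      exact mul_left_cancel₀ hn.ne' h
    have hA : (1 / (Fintype.card V : ℝ)) * (G.adjMatrix ℝ * Q) v w =
        neighborMean G (χ (Sum.inr w) ∘ Sum.inl) v /
          (Fintype.card V * Fintype.card W * p (Sum.inr w)) := by
      rw [Matrix.mul_apply, neighborMean]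
      simp only [hQ, ← mul_div_assoc, ← Finset.sum_div, Function.comp_apply]
      ring
    have hB : (1 / (Fintype.card W : ℝ)) * (Q * H.adjMatrix ℝ) v w =
        neighborMean H (χ (Sum.inl v) ∘ Sum.inr) w /
          (Fintype.card V * Fintype.card W * p (Sum.inl v)) := by
      rw [Matrix.mul_apply, neighborMean]
      simp only [Q, div_mul_eq_mul_div, ← Finset.sum_div, Function.comp_apply,
        SimpleGraph.adjMatrix_apply, H.adj_comm w, mul_comm (χ _ _)]
      ring
    simp only [discrepancy, Matrix.sub_apply, Matrix.smul_apply, smul_eq_mul, hA, hB,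
      Matrix.zero_apply]
    field_simp
    linarith

end Intertwiner

/-! ### When the distances vanish -/

section Distances

variable {V W : Type*} [Fintype V] [Fintype W]

theorem entrywiseOneNorm_eq_zero_iff (A : Matrix V W ℝ) : entrywiseOneNorm A = 0 ↔ A = 0 := by
  constructor
  · intro h
    ext v w
    unfold entrywiseOneNorm at h
    rw [Finset.sum_eq_zero_iff_of_nonneg
      fun v _ => Finset.sum_nonneg fun w _ => abs_nonneg _] at h
    have h' := h v (Finset.mem_univ v)
    rw [Finset.sum_eq_zero_iff_of_nonneg fun w _ => abs_nonneg _] at h'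
    exact abs_eq_zero.1 (h' w (Finset.mem_univ w))
  · rintro rfl
    simp [entrywiseOneNorm]

/-- Singletons `S` and `T` already detect each entry. -/
theorem cutNorm_eq_zero_iff (A : Matrix V W ℝ) : cutNorm A = 0 ↔ A = 0 := by
  constructor
  · intro h
    ext v w
    have hle : |∑ v' ∈ {v}, ∑ w' ∈ {w}, A v' w'| ≤ cutNorm A :=
      Finset.le_sup' (fun p : Finset V × Finset W => |∑ v ∈ p.1, ∑ w ∈ p.2, A v w|)
        (Finset.mem_univ ({v}, {w}))
    rw [h, Finset.sum_singleton, Finset.sum_singleton] at hle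
    exact abs_nonpos_iff.1 hle
  · rintro rfl
    simp [cutNorm]

variable [Nonempty V] [Nonempty W] (G : SimpleGraph V) (H : SimpleGraph W)
  [DecidableRel G.Adj] [DecidableRel H.Adj]

/-- Attainment of the minimum turns a zero distance into an actual intertwiner, so the choice of
norm is immaterial. -/
theorem fractionalDist_eq_zero_iff {N : Matrix V W ℝ → ℝ} (hN : Continuous N)
    (h0 : ∀ A, 0 ≤ N A) (hN0 : ∀ A, N A = 0 ↔ A = 0) :
    fractionalDist N G H = 0 ↔ ∃ Q ∈ DSStar V W, discrepancy G H Q = 0 := by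
  have hl := fractionalDist_isLeast hN G H
  constructor
  · intro h
    obtain ⟨Q, hQ, hQ'⟩ := hl.1
    exact ⟨Q, hQ, (hN0 _).1 (hQ'.trans h)⟩
  · rintro ⟨Q, hQ, hQ'⟩
    refine le_antisymm ((hl.2 ⟨Q, hQ, rfl⟩).trans_eq ((hN0 _).2 hQ')) ?_
    obtain ⟨Q, -, hQ'⟩ := hl.1
    rw [← hQ']
    exact h0 _

theorem fractionalEditDist_eq_zero_iff :
    fractionalEditDist G H = 0 ↔ ∃ Q ∈ DSStar V W, discrepancy G H Q = 0 :=
  fractionalDist_eq_zero_iff G H continuous_entrywiseOneNorm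
    (fun _ => Finset.sum_nonneg fun _ _ => Finset.sum_nonneg fun _ _ => abs_nonneg _)
    entrywiseOneNorm_eq_zero_iff

theorem fractionalCutDist_eq_zero_iff :
    fractionalCutDist G H = 0 ↔ ∃ Q ∈ DSStar V W, discrepancy G H Q = 0 :=
  fractionalDist_eq_zero_iff G H continuous_cutNorm
    (fun _ => Finset.le_sup'_of_le _ (Finset.mem_univ (∅, ∅)) (abs_nonneg _))
    cutNorm_eq_zero_iff

omit [Nonempty V] [Nonempty W] [DecidableRel G.Adj] [DecidableRel H.Adj] in
theorem homDensityDist_eq_zero_iff (𝓕 : (k : ℕ) → Set (SimpleGraph (Fin k))) :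
    homDensityDist 𝓕 G H = 0 ↔ ∀ k, ∀ F ∈ 𝓕 k, homDensity F G = homDensity F H := by
  have hmem : ∀ k F, F ∈ members 𝓕 k ↔ F ∈ 𝓕 k := by simp [members]
  have h0 : ∀ k, 0 ≤ homDensityTerm 𝓕 G H k := fun k => by
    unfold homDensityTerm
    positivity
  rw [homDensityDist, Real.sqrt_eq_zero (tsum_nonneg h0),
    ← (summable_homDensityTerm 𝓕 G H).hasSum_iff, hasSum_zero_iff_of_nonneg h0, funext_iff]
  refine forall_congr' fun k => ?_
  simp only [← hmem]
  rw [homDensityTerm, Pi.zero_apply, mul_eq_zero,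
    Finset.sum_eq_zero_iff_of_nonneg fun _ _ => sq_nonneg _]
  simp only [pow_eq_zero_iff two_ne_zero, sub_eq_zero]
  -- The coefficient is zero only for an order without members, where the claim is vacuous.
  refine or_iff_right_of_imp fun h F hF => ?_
  have hpos : (0 : ℝ) < (members 𝓕 k).card := by exact_mod_cast Finset.card_pos.2 ⟨F, hF⟩
  exact absurd h (by positivity)

end Distances

end

end GraphDistance


theorem mainTheorem8 {V W : Type*} [Fintype V] [Fintype W] [Nonempty V] [Nonempty W]
    (G : SimpleGraph V) (H : SimpleGraph W) [DecidableRel G.Adj] [DecidableRel H.Adj] :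
    (GraphDistance.homDensityDist GraphDistance.trees G H = 0 ↔
      GraphDistance.fractionalEditDist G H = 0) ∧
    (GraphDistance.fractionalEditDist G H = 0 ↔
      GraphDistance.fractionalCutDist G H = 0) := by
  have hiff : GraphDistance.homDensityDist GraphDistance.trees G H = 0 ↔
      ∃ Q ∈ GraphDistance.DSStar V W, GraphDistance.discrepancy G H Q = 0 := by
    rw [GraphDistance.homDensityDist_eq_zero_iff]
    exact ⟨fun h => GraphDistance.exists_discrepancy_eq_zero h, fun ⟨Q, hQ, hd⟩ k F hF =>
      GraphDistance.homDensity_eq_of_discrepancy_eq_zero hQ hd hF⟩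
  rw [hiff, GraphDistance.fractionalEditDist_eq_zero_iff,
    GraphDistance.fractionalCutDist_eq_zero_iff]
  exact ⟨Iff.rfl, Iff.rfl⟩
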